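/- For $\omega>0$ let $\lambda=2\pi/\omega$ and let $$G(x,y)=\tfrac{i}{4}\,H^{(1)}_0(\omega|x-y|),\qquad x,y\in\mathbb{R}^2,\ x\ne y,$$ be the Green's function of the two-dimensional Helmholtz equation, where $H^{(1)}_0=J_0+iY_0$ is the Hankel function of the first kind of order zero and $|\cdot|$ is the Euclidean norm. For real numbers $d,h_1,h_2$ put $$R_1=\left[\tfrac{d}{2}\lambda,\tfrac{3d}{2}\lambda\right]\times\left[-\tfrac{h_1}{2}\lambda,\tfrac{h_1}{2}\lambda\right],\qquad R_2=\left[-\tfrac{3d}{2}\lambda,-\tfrac{d}{2}\lambda\right]\times\left[-\tfrac{h_2}{2}\lambda,\tfrac{h_2}{2}\lambda\right].$$ Then for every sufficiently small $\epsilon>0$ there is a natural number $C(\epsilon)$, depending only on $\epsilon$ (in particular independent of $\omega$ and $d$, and of $h_1,h_2$), such that for all $\omega>0$ and all $d,h_1,h_2$ with $d>1$ and $d\ge 2\max(h_1,h_2)^2$ the function $G(x,y)$ with $x\in R_1$, $y\in R_2$ has a separated approximation of $C(\epsilon)$ terms with relative accuracy $\epsilon$; that is, there exist functions $\alpha_i:R_1\to\mathbb{C}$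 and $\beta_i:R_2\to\mathbb{C}$, $1\le i\le C(\epsilon)$ (which may depend on $\epsilon,\omega,d,h_1,h_2$), such that $$\Big|G(x,y)-\sum_{i=1}^{C(\epsilon)}\alpha_i(x)\beta_i(y)\Big|\le\epsilon\,|G(x,y)|\qquad\text{for all }x\in R_1,\ y\in R_2.$$ -/

import Mathlib

noncomputable section

/-- The Bessel function of the first kind of order zero (real argument),
`J₀(z) = ∑_{k ≥ 0} (-1)^k (z²/4)^k / (k!)²`. -/
def besselJ0 (z : ℝ) : ℝ :=
  ∑' k : ℕ, (-1) ^ k * (z ^ 2 / 4) ^ k / (k.factorial : ℝ) ^ 2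

/-- The Bessel function of the second kind of order zero (real argument `z > 0`),
`Y₀(z) = (2/π) (log (z/2) + γ) J₀(z) - (2/π) ∑_{k ≥ 0} (-1)^k H_k (z²/4)^k / (k!)²`,
with `γ` Euler's constant and `H_k` the harmonic numbers (`H_0 = 0`). -/
def besselY0 (z : ℝ) : ℝ :=
  2 / Real.pi * (Real.log (z / 2) + Real.eulerMascheroniConstant) * besselJ0 z
    - 2 / Real.pi *
      ∑' k : ℕ, (-1) ^ k * (harmonic k : ℝ) * (z ^ 2 / 4) ^ k / (k.factorial : ℝ) ^ 2

/-- The Hankel function of the first kind of order zero, `H₀⁽¹⁾ = J₀ + i Y₀`. -/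
def hankelH10 (z : ℝ) : ℂ :=
  (besselJ0 z : ℂ) + Complex.I * (besselY0 z : ℂ)

/-- The power series in `besselY0` converges. -/
theorem summable_besselY0_series (z : ℝ) :
    Summable fun k : ℕ =>
      (-1 : ℝ) ^ k * (harmonic k : ℝ) * (z ^ 2 / 4) ^ k / (k.factorial : ℝ) ^ 2 := by
  refine Summable.of_norm_bounded (Real.summable_pow_div_factorial (z ^ 2 / 4)) fun k => ?_
  have hf : (0 : ℝ) < k.factorial := by exact_mod_cast k.factorial_pos
  have h0 : (0 : ℚ) ≤ harmonic k := Finset.sum_nonneg fun i _ => by positivity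
  have h1 : harmonic k ≤ (k : ℚ) := by
    calc harmonic k ≤ ∑ i ∈ Finset.range k, (1 : ℚ) := by
          refine Finset.sum_le_sum fun i _ => inv_le_one_of_one_le₀ ?_
          exact_mod_cast Nat.succ_le_succ (Nat.zero_le i)
      _ = k := by simp
  have h1' : (harmonic k : ℝ) ≤ (k : ℝ) := by exact_mod_cast h1
  have hk : (k : ℝ) ≤ k.factorial := by exact_mod_cast k.self_le_factorial
  have h2 : (harmonic k : ℝ) ≤ k.factorial := h1'.trans hk
  have h0' : (0 : ℝ) ≤ harmonic k := by exact_mod_cast h0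
  have hz : (0 : ℝ) ≤ (z ^ 2 / 4) ^ k := by positivity
  rw [norm_div, norm_mul, norm_mul, norm_pow, norm_neg, norm_one, one_pow, one_mul,
    Real.norm_of_nonneg h0', Real.norm_of_nonneg hz, Real.norm_of_nonneg (by positivity),
    div_le_div_iff₀ (by positivity) hf]
  nlinarith [mul_le_mul_of_nonneg_right h2 (mul_nonneg hz hf.le)]

/-- The power series in `besselJ0` converges. -/
theorem summable_besselJ0_series (z : ℝ) :
    Summable fun k : ℕ => (-1 : ℝ) ^ k * (z ^ 2 / 4) ^ k / (k.factorial : ℝ) ^ 2 := by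
  refine Summable.of_norm_bounded (Real.summable_pow_div_factorial (z ^ 2 / 4)) fun k => ?_
  have hf : (1 : ℝ) ≤ k.factorial := by exact_mod_cast k.factorial_pos
  have hz : (0 : ℝ) ≤ (z ^ 2 / 4) ^ k := by positivity
  rw [norm_div, norm_mul, norm_pow, norm_neg, norm_one, one_pow, one_mul,
    Real.norm_of_nonneg hz, Real.norm_of_nonneg (by positivity)]
  exact div_le_div_of_nonneg_left hz (by positivity) (by nlinarith)

/-- The Green's function of the two-dimensional Helmholtz equation,
`G(x, y) = (i/4) H₀⁽¹⁾(ω |x - y|)`, with the Euclidean norm on the plane. -/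
def helmholtzGreen (ω : ℝ) (x y : EuclideanSpace ℝ (Fin 2)) : ℂ :=
  Complex.I / 4 * hankelH10 (ω * ‖x - y‖)

/-- The wavelength `λ = 2π/ω`. -/
def wavelength (ω : ℝ) : ℝ := 2 * Real.pi / ω

/-- The closed axis-parallel rectangle `[a, b] × [c, e]` in the plane. -/
def planeRect (a b c e : ℝ) : Set (EuclideanSpace ℝ (Fin 2)) :=
  {x | x 0 ∈ Set.Icc a b ∧ x 1 ∈ Set.Icc c e}

/-- `H(x, y)`, with `x ∈ X` and `y ∈ Y`, has a separated approximation of `n` terms with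
relative accuracy `ε`. -/
def HasSeparatedApprox {E F : Type*} (H : E → F → ℂ) (X : Set E) (Y : Set F)
    (n : ℕ) (ε : ℝ) : Prop :=
  ∃ (α : Fin n → E → ℂ) (β : Fin n → F → ℂ), ∀ x ∈ X, ∀ y ∈ Y,
    ‖H x y - ∑ i, α i x * β i y‖ ≤ ε * ‖H x y‖

end

/-!
Why a number of terms independent of `d` suffices. In the scaled coordinates
`ξ = (x₁ / (d λ), x₂ / (√d λ))`, and `η` likewise for `y`, the two rectangles lie in fixed compact
boxes; for the vertical coordinate this is the condition `d ≥ 2 max(h₁, h₂)²`. There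
`ω |x - y| = 2π d ρ` with `ρ² = (ξ₁ - η₁)² + (ξ₂ - η₂)² / d`, and `1 ≤ ρ ≤ 4`. The only quantity
that is not under control by compactness is the large factor `d` in the phase, and it separates:
`d ρ = d ξ₁ - d η₁ + (ξ₂ - η₂)² / (ρ + ξ₁ - η₁)` (`mul_scaledDist`), where the last term is a
continuous function of `(1 / d, ξ, η)` down to `1 / d = 0`.

Continuous functions on a product of compact sets are uniform limits of separated sums
(`exists_isSeparatedSum_near`), and a parameter in a compact set can be absorbed into the first
variable. For `d` large, `√z H₀⁽¹⁾(z) = A e^{iz} + B e^{-iz} + o(1)` (`exists_tendsto_hankelH10`)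
reduces the problem to `e^{± 2π i d ρ} / √ρ`, that is, to separated plane waves times such a
continuous function (`exists_isSeparatedSum_exp`). The remaining `d` form a compact interval,
on which the compactness argument applies to the Hankel function itself. The values of `A` and `B`
do not matter.

Absolute accuracy turns into relative accuracy by the bound `√z |H₀⁽¹⁾(z)| ≥ c` for `z ≥ 1`
(`exists_le_sqrt_mul_norm_hankelH10`). This bound and the asymptotics come from Bessel's equation:
for a real solution `f`, the function `u = √z f` satisfies `u'' + (1 + 1 / (4 z²)) u = 0`, its energy
decreases, so `u` and `u'` are bounded, and `(e^{-iz} (u' + i u))' = O(z⁻²)`. The Wronskian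
`z (J₀ Y₀' - J₀' Y₀) = 2 / π` then keeps `√z J₀` and `√z Y₀` from being small simultaneously.
The equation and the Wronskian are derived from the power series.
-/

open Filter Topology

/-! ### Everywhere convergent power series -/

/-- The sum of the real power series with coefficients `a`. -/
noncomputable def powerSum (a : ℕ → ℝ) (x : ℝ) : ℝ := ∑' k, a k * x ^ k

/-- The coefficients of the termwise derivative of the power series with coefficients `a`. -/
def derivCoeff (a : ℕ → ℝ) (k : ℕ) : ℝ := (k + 1) * a (k + 1)

lemma summable_mul_pow {a : ℕ → ℝ} (ha : ∀ k, |a k| ≤ 1 / k.factorial) (x : ℝ) :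
    Summable fun k => a k * x ^ k := by
  refine Summable.of_norm_bounded (Real.summable_pow_div_factorial |x|) fun k => ?_
  rw [norm_mul, norm_pow, Real.norm_eq_abs, Real.norm_eq_abs, div_eq_inv_mul, ← one_div]
  gcongr
  exact ha k

lemma abs_derivCoeff_le {a : ℕ → ℝ} (ha : ∀ k, |a k| ≤ 1 / k.factorial) (k : ℕ) :
    |derivCoeff a k| ≤ 1 / k.factorial := by
  have h := ha (k + 1)
  have hf : (0 : ℝ) < k.factorial := by exact_mod_cast k.factorial_pos
  rw [derivCoeff, abs_mul, abs_of_nonneg (by positivity : (0 : ℝ) ≤ k + 1)]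
  calc ((k : ℝ) + 1) * |a (k + 1)| ≤ (k + 1) * (1 / (k + 1).factorial) := by gcongr
    _ = 1 / k.factorial := by
      rw [Nat.factorial_succ]; push_cast; field_simp

lemma tsum_nat_mul_pow_pred {a : ℕ → ℝ} (ha : ∀ k, |a k| ≤ 1 / k.factorial) (x : ℝ) :
    ∑' k, a k * (k * x ^ (k - 1)) = powerSum (derivCoeff a) x := by
  have hs : Summable fun k => a k * ((k : ℝ) * x ^ (k - 1)) := by
    rw [← summable_nat_add_iff 1]
    refine (summable_mul_pow (abs_derivCoeff_le ha) x).congr fun k => ?_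
    simp only [derivCoeff, Nat.add_sub_cancel]; push_cast; ring
  rw [hs.tsum_eq_zero_add, powerSum]
  simp only [Nat.cast_zero, zero_mul, mul_zero, zero_add]
  refine tsum_congr fun k => ?_
  simp only [derivCoeff, Nat.add_sub_cancel]; push_cast; ring

lemma hasDerivAt_powerSum {a : ℕ → ℝ} (ha : ∀ k, |a k| ≤ 1 / k.factorial) (x : ℝ) :
    HasDerivAt (powerSum a) (powerSum (derivCoeff a) x) x := by
  rw [← tsum_nat_mul_pow_pred ha]
  have hu : Summable fun k : ℕ => 1 / (k.factorial : ℝ) * (k * (|x| + 1) ^ (k - 1)) := by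
    rw [← summable_nat_add_iff 1]
    refine (Real.summable_pow_div_factorial (|x| + 1)).congr fun k => ?_
    have hf : (0 : ℝ) < k.factorial := by exact_mod_cast k.factorial_pos
    rw [Nat.factorial_succ, Nat.add_sub_cancel]; push_cast; field_simp
  have hx : x ∈ Metric.ball (0 : ℝ) (|x| + 1) := by simp
  refine hasDerivAt_tsum_of_isPreconnected (g := fun k y => a k * y ^ k)
    (g' := fun k y => a k * (k * y ^ (k - 1))) hu Metric.isOpen_ball
    (convex_ball (0 : ℝ) _).isPreconnected (fun k y _ => (hasDerivAt_pow k y).const_mul _)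
    (fun k y hy => ?_) hx (summable_mul_pow ha x) hx
  have hy' : |y| ≤ |x| + 1 := by simpa using (Metric.mem_ball.1 hy).le
  rw [norm_mul, norm_mul, norm_pow, Real.norm_eq_abs, Real.norm_eq_abs, Real.norm_eq_abs,
    Nat.abs_cast]
  gcongr
  exact ha k

/-- The identity `x f'(x) + f(x) = (x f(x))'` on the level of coefficients. -/
lemma mul_powerSum_derivCoeff_add {c : ℕ → ℝ} (hc : ∀ k, |c k| ≤ 1 / k.factorial) (x : ℝ) :
    x * powerSum (derivCoeff c) x + powerSum c x = powerSum (fun k => (k + 1) * c k) x := by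
  have h1 := summable_mul_pow (abs_derivCoeff_le hc) x
  have hs : Summable fun k : ℕ => (k : ℝ) * c k * x ^ k := by
    rw [← summable_nat_add_iff 1]
    refine (h1.mul_left x).congr fun k => ?_
    simp only [derivCoeff]; push_cast; ring
  have h2 : x * powerSum (derivCoeff c) x = ∑' k : ℕ, (k : ℝ) * c k * x ^ k := by
    rw [hs.tsum_eq_zero_add, powerSum, ← tsum_mul_left]
    simp only [Nat.cast_zero, zero_mul, zero_add]
    refine tsum_congr fun k => ?_
    simp only [derivCoeff]; push_cast; ring
  rw [h2, powerSum, powerSum, ← hs.tsum_add (summable_mul_pow hc x)]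
  exact tsum_congr fun k => by ring

/-! ### Bessel's equation and the Wronskian -/

/-- The coefficients of `J₀(2√x)` as a power series in `x`. -/
noncomputable def coeffJ (k : ℕ) : ℝ := (-1) ^ k / (k.factorial : ℝ) ^ 2

/-- The coefficients of the power series part of `Y₀(2√x)`. -/
noncomputable def coeffY (k : ℕ) : ℝ := (-1) ^ k * (harmonic k : ℝ) / (k.factorial : ℝ) ^ 2

lemma abs_coeffJ_le (k : ℕ) : |coeffJ k| ≤ 1 / k.factorial := by
  have hf : (1 : ℝ) ≤ k.factorial := by exact_mod_cast k.factorial_pos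
  rw [coeffJ, abs_div, abs_pow, abs_neg, abs_one, one_pow, abs_of_nonneg (by positivity)]
  exact div_le_div_of_nonneg_left zero_le_one (by positivity) (by nlinarith)

lemma abs_coeffY_le (k : ℕ) : |coeffY k| ≤ 1 / k.factorial := by
  have hf : (0 : ℝ) < k.factorial := by exact_mod_cast k.factorial_pos
  have h0 : (0 : ℚ) ≤ harmonic k := Finset.sum_nonneg fun i _ => by positivity
  have h1 : harmonic k ≤ (k : ℚ) := by
    calc harmonic k ≤ ∑ i ∈ Finset.range k, (1 : ℚ) := by
          refine Finset.sum_le_sum fun i _ => inv_le_one_of_one_le₀ ?_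
          exact_mod_cast Nat.succ_le_succ (Nat.zero_le i)
      _ = k := by simp
  have h0' : (0 : ℝ) ≤ harmonic k := by exact_mod_cast h0
  have h1' : (harmonic k : ℝ) ≤ k := by exact_mod_cast h1
  have h2 : (harmonic k : ℝ) ≤ k.factorial := h1'.trans (by exact_mod_cast k.self_le_factorial)
  rw [coeffY, abs_div, abs_mul, abs_pow, abs_neg, abs_one, one_pow, one_mul,
    abs_of_nonneg h0', abs_of_nonneg (by positivity), div_le_div_iff₀ (by positivity) hf]
  nlinarith

lemma besselJ0_eq_powerSum (z : ℝ) : besselJ0 z = powerSum coeffJ (z ^ 2 / 4) :=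
  tsum_congr fun k => by rw [coeffJ]; ring

lemma besselY0_eq_powerSum (z : ℝ) :
    besselY0 z = 2 / Real.pi * ((Real.log (z / 2) + Real.eulerMascheroniConstant) *
      powerSum coeffJ (z ^ 2 / 4) - powerSum coeffY (z ^ 2 / 4)) := by
  have h : ∑' k : ℕ, (-1 : ℝ) ^ k * (harmonic k : ℝ) * (z ^ 2 / 4) ^ k / (k.factorial : ℝ) ^ 2
      = powerSum coeffY (z ^ 2 / 4) := tsum_congr fun k => by rw [coeffY]; ring
  rw [besselY0, besselJ0_eq_powerSum, h]; ring

/-- With `φ(x) = J₀(2√x)`, Bessel's equation reads `x φ'' + φ' + φ = 0`. -/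
lemma powerSum_coeffJ_ode (x : ℝ) :
    x * powerSum (derivCoeff (derivCoeff coeffJ)) x + powerSum (derivCoeff coeffJ) x
      = -powerSum coeffJ x := by
  rw [mul_powerSum_derivCoeff_add (abs_derivCoeff_le abs_coeffJ_le), powerSum, powerSum,
    ← tsum_neg]
  refine tsum_congr fun k => ?_
  have hf : (k.factorial : ℝ) ≠ 0 := by exact_mod_cast k.factorial_ne_zero
  simp only [derivCoeff, coeffJ, Nat.factorial_succ]
  push_cast
  field_simp
  ring

/-- The power series part `ψ` of `Y₀` solves the inhomogeneous equation
`x ψ'' + ψ' + ψ = φ'`; the right-hand side is what the term `log (z / 2) * J₀` produces. -/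
lemma powerSum_coeffY_ode (x : ℝ) :
    x * powerSum (derivCoeff (derivCoeff coeffY)) x + powerSum (derivCoeff coeffY) x
      = powerSum (derivCoeff coeffJ) x - powerSum coeffY x := by
  rw [mul_powerSum_derivCoeff_add (abs_derivCoeff_le abs_coeffY_le), powerSum, powerSum, powerSum,
    ← (summable_mul_pow (abs_derivCoeff_le abs_coeffJ_le) x).tsum_sub
      (summable_mul_pow abs_coeffY_le x)]
  refine tsum_congr fun k => ?_
  have hf : (k.factorial : ℝ) ≠ 0 := by exact_mod_cast k.factorial_ne_zero
  simp only [derivCoeff, coeffJ, coeffY, Nat.factorial_succ, harmonic_succ]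
  push_cast
  field_simp
  ring

/-- `f` solves Bessel's equation `f'' + f' / z + f = 0` of order zero on `(0, ∞)`, with
derivative `f'`. -/
def IsBesselSolution (f f' : ℝ → ℝ) : Prop :=
  ∀ z, 0 < z → HasDerivAt f (f' z) z ∧ HasDerivAt f' (-(f' z) / z - f z) z

/-- The derivative of `J₀`. -/
noncomputable def besselJ0Deriv (z : ℝ) : ℝ := powerSum (derivCoeff coeffJ) (z ^ 2 / 4) * (z / 2)

/-- The derivative of `Y₀` on `(0, ∞)`. -/
noncomputable def besselY0Deriv (z : ℝ) : ℝ :=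
  2 / Real.pi * (powerSum coeffJ (z ^ 2 / 4) / z +
    (Real.log (z / 2) + Real.eulerMascheroniConstant) * besselJ0Deriv z -
    powerSum (derivCoeff coeffY) (z ^ 2 / 4) * (z / 2))

lemma hasDerivAt_powerSum_sq_div_four {a : ℕ → ℝ} (ha : ∀ k, |a k| ≤ 1 / k.factorial) (z : ℝ) :
    HasDerivAt (fun z => powerSum a (z ^ 2 / 4))
      (powerSum (derivCoeff a) (z ^ 2 / 4) * (z / 2)) z := by
  have h : HasDerivAt (fun z : ℝ => z ^ 2 / 4) (z / 2) z :=
    ((hasDerivAt_pow 2 z).div_const 4).congr_deriv (by norm_num; ring)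
  exact (hasDerivAt_powerSum ha _).comp z h

lemma hasDerivAt_besselJ0Deriv (z : ℝ) :
    HasDerivAt besselJ0Deriv
      (powerSum (derivCoeff (derivCoeff coeffJ)) (z ^ 2 / 4) * (z / 2) * (z / 2) +
        powerSum (derivCoeff coeffJ) (z ^ 2 / 4) * (1 / 2)) z :=
  (hasDerivAt_powerSum_sq_div_four (abs_derivCoeff_le abs_coeffJ_le) z).mul
    ((hasDerivAt_id z).div_const 2)

lemma isBesselSolution_besselJ0 : IsBesselSolution besselJ0 besselJ0Deriv := by
  intro z hz
  refine ⟨?_, ?_⟩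
  · rw [funext besselJ0_eq_powerSum]
    exact hasDerivAt_powerSum_sq_div_four abs_coeffJ_le z
  · refine (hasDerivAt_besselJ0Deriv z).congr_deriv ?_
    have h := powerSum_coeffJ_ode (z ^ 2 / 4)
    rw [besselJ0_eq_powerSum, besselJ0Deriv]
    field_simp
    linear_combination 4 * h

lemma isBesselSolution_besselY0 : IsBesselSolution besselY0 besselY0Deriv := by
  intro z hz
  have hlog : HasDerivAt (fun z => Real.log (z / 2) + Real.eulerMascheroniConstant) (1 / z) z := by
    refine ((((hasDerivAt_id z).div_const 2).log (by simp [hz.ne'])).add_const _).congr_deriv ?_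
    simp only [id]; field_simp
  have hJ := hasDerivAt_powerSum_sq_div_four abs_coeffJ_le z
  have hY := hasDerivAt_powerSum_sq_div_four abs_coeffY_le z
  have hY' := (hasDerivAt_powerSum_sq_div_four (abs_derivCoeff_le abs_coeffY_le) z).mul
    ((hasDerivAt_id z).div_const 2)
  refine ⟨?_, ?_⟩
  · rw [funext besselY0_eq_powerSum]
    refine (((hlog.mul hJ).sub hY).const_mul (2 / Real.pi)).congr_deriv ?_
    rw [besselY0Deriv, besselJ0Deriv]; ring
  · refine ((((hJ.div (hasDerivAt_id z) hz.ne').add (hlog.mul (hasDerivAt_besselJ0Deriv z))).sub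
      hY').const_mul (2 / Real.pi)).congr_deriv ?_
    have h1 := powerSum_coeffJ_ode (z ^ 2 / 4)
    have h2 := powerSum_coeffY_ode (z ^ 2 / 4)
    have hpi := Real.pi_ne_zero
    rw [besselY0_eq_powerSum, besselY0Deriv, besselJ0Deriv]
    simp only [id]
    field_simp
    linear_combination
      4 * z ^ 2 * (Real.log (z / 2) + Real.eulerMascheroniConstant) * h1 - 4 * z ^ 2 * h2

/-- The logarithms cancel in the Wronskian of `J₀` and `Y₀`; the remaining expression in power
series is constant, and its value can be read off at `0`. -/
lemma powerSum_wronskian (x : ℝ) :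
    powerSum coeffJ x ^ 2 / 2 + x * (powerSum (derivCoeff coeffJ) x * powerSum coeffY x -
      powerSum coeffJ x * powerSum (derivCoeff coeffY) x) = 1 / 2 := by
  have hJ := fun x => hasDerivAt_powerSum abs_coeffJ_le x
  have hJ' := fun x => hasDerivAt_powerSum (abs_derivCoeff_le abs_coeffJ_le) x
  have hY := fun x => hasDerivAt_powerSum abs_coeffY_le x
  have hY' := fun x => hasDerivAt_powerSum (abs_derivCoeff_le abs_coeffY_le) x
  have hW : ∀ x, HasDerivAt (fun x => powerSum coeffJ x ^ 2 / 2 + x *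
      (powerSum (derivCoeff coeffJ) x * powerSum coeffY x -
        powerSum coeffJ x * powerSum (derivCoeff coeffY) x)) 0 x := by
    intro x
    refine ((((hJ x).pow 2).div_const 2).add ((hasDerivAt_id x).mul
      (((hJ' x).mul (hY x)).sub ((hJ x).mul (hY' x))))).congr_deriv ?_
    have h1 := powerSum_coeffJ_ode x
    have h2 := powerSum_coeffY_ode x
    simp only [id, Pi.sub_apply, Pi.mul_apply]
    push_cast
    linear_combination powerSum coeffY x * h1 - powerSum coeffJ x * h2
  have h0 : powerSum coeffJ 0 = 1 := by
    rw [powerSum, tsum_eq_single 0 fun k hk => by simp [hk]]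
    simp [coeffJ]
  have := is_const_of_deriv_eq_zero (fun x => (hW x).differentiableAt) (fun x => (hW x).deriv) x 0
  rw [this, h0]; norm_num

lemma bessel_wronskian {z : ℝ} (hz : 0 < z) :
    z * (besselJ0 z * besselY0Deriv z - besselJ0Deriv z * besselY0 z) = 2 / Real.pi := by
  have h := powerSum_wronskian (z ^ 2 / 4)
  rw [besselJ0_eq_powerSum, besselY0_eq_powerSum, besselY0Deriv, besselJ0Deriv]
  have hpi := Real.pi_ne_zero
  field_simp
  linear_combination 4 * h

/-! ### Solutions of Bessel's equation for large arguments -/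

/-- The derivative of `√z f(z)`, where `f'` is the derivative of `f`. -/
noncomputable def sqrtMulDeriv (f f' : ℝ → ℝ) (z : ℝ) : ℝ := √z * f' z + f z / (2 * √z)

namespace IsBesselSolution

variable {f f' : ℝ → ℝ}

lemma hasDerivAt_sqrt_mul (h : IsBesselSolution f f') {z : ℝ} (hz : 0 < z) :
    HasDerivAt (fun z => √z * f z) (sqrtMulDeriv f f' z) z := by
  refine ((Real.hasDerivAt_sqrt hz.ne').mul (h z hz).1).congr_deriv ?_
  rw [sqrtMulDeriv]; ring

lemma hasDerivAt_sqrtMulDeriv (h : IsBesselSolution f f') {z : ℝ} (hz : 0 < z) :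
    HasDerivAt (sqrtMulDeriv f f') (-(1 + 1 / (4 * z ^ 2)) * (√z * f z)) z := by
  have hs : 0 < √z := Real.sqrt_pos.2 hz
  have hd := Real.hasDerivAt_sqrt hz.ne'
  refine ((hd.mul (h z hz).2).add ((h z hz).1.div (hd.const_mul 2) (by positivity))).congr_deriv ?_
  obtain ⟨s, hs0, rfl⟩ : ∃ s, 0 < s ∧ z = s ^ 2 := ⟨√z, hs, (Real.sq_sqrt hz.le).symm⟩
  rw [Real.sqrt_sq hs0.le]
  field_simp
  ring

/-- The energy `u'² + (1 + 1 / (4 z²)) u²` of `u = √z f` decreases, so `u` and `u'` are bounded. -/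
lemma exists_bound (h : IsBesselSolution f f') :
    ∃ M, 0 < M ∧ ∀ z, 1 ≤ z → |√z * f z| ≤ M ∧ |sqrtMulDeriv f f' z| ≤ M := by
  set F : ℝ → ℝ := fun z => sqrtMulDeriv f f' z ^ 2 + (1 + 1 / (4 * z ^ 2)) * (√z * f z) ^ 2
  have hF : ∀ z, 0 < z → HasDerivAt F (-(√z * f z) ^ 2 / (2 * z ^ 3)) z := by
    intro z hz
    have hq : HasDerivAt (fun z : ℝ => 1 + 1 / (4 * z ^ 2)) (-(1 / (2 * z ^ 3))) z := by
      refine (((hasDerivAt_const z (1 : ℝ)).div ((hasDerivAt_pow 2 z).const_mul 4)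
        (by positivity)).const_add 1).congr_deriv ?_
      field_simp; norm_num; ring
    refine (((h.hasDerivAt_sqrtMulDeriv hz).pow 2).add
      (hq.mul ((h.hasDerivAt_sqrt_mul hz).pow 2))).congr_deriv ?_
    simp only [Pi.pow_apply]
    field_simp
    ring
  have hanti : AntitoneOn F (Set.Ici 1) := by
    refine antitoneOn_of_deriv_nonpos (convex_Ici 1)
      (fun z hz => (hF z (zero_lt_one.trans_le hz)).continuousAt.continuousWithinAt)
      (fun z hz => ?_) (fun z hz => ?_) <;> rw [interior_Ici, Set.mem_Ioi] at hz
    · exact (hF z (by linarith)).differentiableAt.differentiableWithinAt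
    · have hz0 : 0 < z := by linarith
      rw [(hF z hz0).deriv]
      exact div_nonpos_of_nonpos_of_nonneg (neg_nonpos.2 (sq_nonneg _)) (by positivity)
  refine ⟨√(F 1) + 1, by positivity, fun z hz => ?_⟩
  have hle : F z ≤ F 1 := hanti Set.self_mem_Ici hz hz
  have hz0 : 0 < z := by linarith
  have hp : 0 ≤ 1 / (4 * z ^ 2) * (√z * f z) ^ 2 := by positivity
  have hFz : F z = sqrtMulDeriv f f' z ^ 2 + (√z * f z) ^ 2 +
    1 / (4 * z ^ 2) * (√z * f z) ^ 2 := by simp only [F]; ring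
  constructor
  · have : |√z * f z| ≤ √(F 1) := Real.abs_le_sqrt (by nlinarith [sq_nonneg (sqrtMulDeriv f f' z)])
    linarith
  · have : |sqrtMulDeriv f f' z| ≤ √(F 1) := Real.abs_le_sqrt (by nlinarith [sq_nonneg (√z * f z)])
    linarith

/-- With `u = √z f`, the derivative of `e^{-iz} (u' + i u)` is `O(z⁻²)`, so that this function has a
limit `ℓ` at infinity. -/
lemma exists_tendsto (h : IsBesselSolution f f') :
    ∃ ℓ : ℂ, Tendsto (fun z : ℝ => √z * f z - (Complex.exp (Complex.I * z) * ℓ).im)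
      atTop (𝓝 0) := by
  obtain ⟨M, hM, hb⟩ := h.exists_bound
  set w : ℝ → ℂ := fun z => Complex.exp (-(Complex.I * z)) *
    ((sqrtMulDeriv f f' z : ℂ) + Complex.I * ((√z * f z : ℝ) : ℂ)) with hw
  set w' : ℝ → ℂ := fun z =>
    Complex.exp (-(Complex.I * z)) * ((-(1 / (4 * z ^ 2)) * (√z * f z) : ℝ) : ℂ) with hw'
  have hder : ∀ z ∈ Set.Ioi (1 : ℝ), HasDerivAt w (w' z) z := by
    intro z hz
    have hz0 : 0 < z := zero_lt_one.trans hz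
    have he : HasDerivAt (fun z : ℝ => Complex.exp (-(Complex.I * z)))
        (Complex.exp (-(Complex.I * z)) * -(Complex.I * 1)) z :=
      (((Complex.ofRealCLM.hasDerivAt (x := z)).const_mul Complex.I).neg).cexp
    refine (he.mul ((h.hasDerivAt_sqrtMulDeriv hz0).ofReal_comp.add
      ((h.hasDerivAt_sqrt_mul hz0).ofReal_comp.const_mul Complex.I))).congr_deriv ?_
    simp only [hw', Pi.add_apply]
    push_cast
    linear_combination -Complex.exp (-(Complex.I * z)) * (√z : ℂ) * (f z : ℂ) * Complex.I_sq
  have hint : MeasureTheory.IntegrableOn w' (Set.Ioi 1) := by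
    have hcont : ContinuousOn w' (Set.Ioi 1) := by
      intro z hz
      have hz0 : 0 < z := zero_lt_one.trans hz
      have h1 := (h.hasDerivAt_sqrt_mul hz0).continuousAt
      have h2 : ContinuousAt (fun z : ℝ => -(1 / (4 * z ^ 2))) z :=
        (continuousAt_const.div (by fun_prop) (by positivity)).neg
      have h3 : ContinuousAt (fun z : ℝ => Complex.exp (-(Complex.I * z))) z := by fun_prop
      exact (h3.mul (Complex.continuous_ofReal.continuousAt.comp (h2.mul h1))).continuousWithinAt
    have hi : MeasureTheory.IntegrableOn (fun z : ℝ => M * z ^ (-2 : ℝ)) (Set.Ioi 1) :=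
      (integrableOn_Ioi_rpow_of_lt (by norm_num) one_pos).const_mul M
    refine hi.mono' (hcont.aestronglyMeasurable measurableSet_Ioi) ?_
    refine (MeasureTheory.ae_restrict_iff' measurableSet_Ioi).2 (Eventually.of_forall ?_)
    intro z hz
    have hz0 : 0 < z := zero_lt_one.trans hz
    have he : ‖Complex.exp (-(Complex.I * z))‖ = 1 := by
      rw [Complex.norm_exp]; simp
    rw [hw', norm_mul, he, one_mul, Complex.norm_real, norm_mul, Real.norm_eq_abs,
      Real.norm_eq_abs, abs_neg, abs_of_nonneg (by positivity), Real.rpow_neg hz0.le,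
      Real.rpow_two, mul_comm]
    have h4 : 1 / (4 * z ^ 2) ≤ (z ^ 2)⁻¹ := by
      rw [← one_div]
      exact one_div_le_one_div_of_le (by positivity) (by nlinarith [sq_nonneg z])
    exact mul_le_mul (hb z hz.le).1 h4 (by positivity) hM.le
  have hlim := MeasureTheory.tendsto_limUnder_of_hasDerivAt_of_integrableOn_Ioi hder hint
  refine ⟨limUnder atTop w, ?_⟩
  set ℓ := limUnder atTop w
  have h0 : Tendsto (fun z => ‖w z - ℓ‖) atTop (𝓝 0) := by
    simpa using (hlim.sub_const ℓ).norm
  refine squeeze_zero_norm (fun z => ?_) h0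
  have hu : √z * f z = (Complex.exp (Complex.I * z) * w z).im := by
    rw [hw, ← mul_assoc, ← Complex.exp_add, add_neg_cancel, Complex.exp_zero, one_mul]
    simp
  have he : ‖Complex.exp (Complex.I * z)‖ = 1 := by
    rw [Complex.norm_exp]; simp
  rw [hu, ← Complex.sub_im, ← mul_sub, Real.norm_eq_abs]
  refine (Complex.abs_im_le_norm _).trans ?_
  rw [norm_mul, he, one_mul]

end IsBesselSolution

/-! ### The Hankel function -/

lemma continuousAt_hankelH10 {z : ℝ} (hz : 0 < z) : ContinuousAt hankelH10 z := by
  have hJ := (isBesselSolution_besselJ0 z hz).1.continuousAt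
  have hY := (isBesselSolution_besselY0 z hz).1.continuousAt
  exact (Complex.continuous_ofReal.continuousAt.comp hJ).add
    (continuousAt_const.mul (Complex.continuous_ofReal.continuousAt.comp hY))

/-- The Wronskian bounds the Hankel function from below: `2 / π` is at most `2 M ‖√z H₀⁽¹⁾(z)‖` when `M`
bounds the derivatives of `√z J₀` and `√z Y₀`. -/
lemma exists_le_sqrt_mul_norm_hankelH10 :
    ∃ c, 0 < c ∧ ∀ z, 1 ≤ z → c ≤ √z * ‖hankelH10 z‖ := by
  obtain ⟨M₁, hM₁, h₁⟩ := isBesselSolution_besselJ0.exists_bound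
  obtain ⟨M₂, hM₂, h₂⟩ := isBesselSolution_besselY0.exists_bound
  refine ⟨2 / Real.pi / (M₁ + M₂), by positivity, fun z hz => ?_⟩
  have hz0 : 0 < z := by linarith
  have hs : 0 < √z := Real.sqrt_pos.2 hz0
  have hW : √z * besselJ0 z * sqrtMulDeriv besselY0 besselY0Deriv z -
      sqrtMulDeriv besselJ0 besselJ0Deriv z * (√z * besselY0 z) = 2 / Real.pi := by
    rw [← bessel_wronskian hz0, sqrtMulDeriv, sqrtMulDeriv]
    have hsq : √z * √z = z := Real.mul_self_sqrt hz0.le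
    field_simp
    linear_combination
      (besselJ0 z * besselY0Deriv z - besselJ0Deriv z * besselY0 z) * 2 * hsq
  have hJ : |besselJ0 z| ≤ ‖hankelH10 z‖ := by
    simpa [hankelH10] using Complex.abs_re_le_norm (hankelH10 z)
  have hY : |besselY0 z| ≤ ‖hankelH10 z‖ := by
    simpa [hankelH10] using Complex.abs_im_le_norm (hankelH10 z)
  rw [div_le_iff₀ (by positivity), ← hW]
  calc _ ≤ |√z * besselJ0 z * sqrtMulDeriv besselY0 besselY0Deriv z| +
        |sqrtMulDeriv besselJ0 besselJ0Deriv z * (√z * besselY0 z)| :=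
        (le_abs_self _).trans (abs_sub _ _)
    _ = √z * |besselJ0 z| * |sqrtMulDeriv besselY0 besselY0Deriv z| +
        |sqrtMulDeriv besselJ0 besselJ0Deriv z| * (√z * |besselY0 z|) := by
        simp only [abs_mul, abs_of_pos hs]
    _ ≤ √z * ‖hankelH10 z‖ * M₂ + M₁ * (√z * ‖hankelH10 z‖) := by
        gcongr
        exacts [(h₂ z hz).2, (h₁ z hz).2]
    _ = √z * ‖hankelH10 z‖ * (M₁ + M₂) := by ring

/-- Only the shape of the leading asymptotics matters below, not the values of `A` and `B`
(in fact `B = 0`). -/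
lemma exists_tendsto_hankelH10 :
    ∃ A B : ℂ, Tendsto (fun z : ℝ => √z * hankelH10 z -
      (A * Complex.exp (Complex.I * z) + B * Complex.exp (-(Complex.I * z)))) atTop (𝓝 0) := by
  obtain ⟨p, hp⟩ := isBesselSolution_besselJ0.exists_tendsto
  obtain ⟨q, hq⟩ := isBesselSolution_besselY0.exists_tendsto
  have hp' := (Complex.continuous_ofReal.tendsto 0).comp hp
  have hq' := (Complex.continuous_ofReal.tendsto 0).comp hq
  have hsum := hp'.add (hq'.const_mul Complex.I)
  rw [Complex.ofReal_zero, mul_zero, add_zero] at hsum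
  have him : ∀ (z : ℝ) (ℓ : ℂ), ((Complex.exp (Complex.I * z) * ℓ).im : ℂ) =
      (Complex.exp (Complex.I * z) * ℓ -
        Complex.exp (-(Complex.I * z)) * (starRingEnd ℂ) ℓ) / (2 * Complex.I) := by
    intro z ℓ
    rw [Complex.im_eq_sub_conj, map_mul, ← Complex.exp_conj, map_mul, Complex.conj_I,
      Complex.conj_ofReal, neg_mul]
  refine ⟨(p + Complex.I * q) / (2 * Complex.I),
    -((starRingEnd ℂ) p + Complex.I * (starRingEnd ℂ) q) / (2 * Complex.I), hsum.congr fun z => ?_⟩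
  simp only [Function.comp_apply, Complex.ofReal_sub, him, hankelH10, Complex.ofReal_mul]
  ring

/-! ### Separated approximations -/

section Separated

variable {E F : Type*}

/-- `f` is a sum of `n` products of a function of the first and a function of the second
variable. -/
def IsSeparatedSum (n : ℕ) (f : E → F → ℂ) : Prop :=
  ∃ (α : Fin n → E → ℂ) (β : Fin n → F → ℂ), ∀ x y, f x y = ∑ i, α i x * β i y

lemma isSeparatedSum_zero (n : ℕ) : IsSeparatedSum n fun (_ : E) (_ : F) => 0 :=
  ⟨fun _ _ => 0, fun _ _ => 0, fun _ _ => by simp⟩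

lemma IsSeparatedSum.add {m n : ℕ} {f g : E → F → ℂ} (hf : IsSeparatedSum m f)
    (hg : IsSeparatedSum n g) : IsSeparatedSum (m + n) fun x y => f x y + g x y := by
  obtain ⟨α, β, h⟩ := hf
  obtain ⟨α', β', h'⟩ := hg
  refine ⟨Fin.append α α', Fin.append β β', fun x y => ?_⟩
  simp [Fin.sum_univ_add, h, h']

lemma IsSeparatedSum.mul {n : ℕ} {f : E → F → ℂ} (hf : IsSeparatedSum n f) (a : E → ℂ)
    (b : F → ℂ) : IsSeparatedSum n fun x y => a x * b y * f x y := by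
  obtain ⟨α, β, h⟩ := hf
  refine ⟨fun i x => a x * α i x, fun i y => b y * β i y, fun x y => ?_⟩
  simp only [h, Finset.mul_sum]
  exact Finset.sum_congr rfl fun i _ => by ring

lemma IsSeparatedSum.comp {E' F' : Type*} {n : ℕ} {f : E → F → ℂ} (hf : IsSeparatedSum n f)
    (a : E' → E) (b : F' → F) : IsSeparatedSum n fun x y => f (a x) (b y) := by
  obtain ⟨α, β, h⟩ := hf
  exact ⟨fun i x => α i (a x), fun i y => β i (b y), fun x y => h _ _⟩

/-- A continuous function on a product of compact sets is uniformly approximated by separated sums: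
replace the second variable by the nearby centre of one of finitely many small balls. -/
lemma exists_isSeparatedSum_near [PseudoMetricSpace E] [PseudoMetricSpace F] {A : Set E} {B : Set F}
    (hA : IsCompact A) (hB : IsCompact B) {f : E → F → ℂ}
    (hf : ContinuousOn (fun p : E × F => f p.1 p.2) (A ×ˢ B)) {ε : ℝ} (hε : 0 < ε) :
    ∃ n g, IsSeparatedSum n g ∧ ∀ x ∈ A, ∀ y ∈ B, ‖f x y - g x y‖ ≤ ε := by
  classical
  have huc := (hA.prod hB).uniformContinuousOn_of_continuous hf
  obtain ⟨δ, hδ, h⟩ := Metric.uniformContinuousOn_iff.1 huc ε hε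
  obtain ⟨t, htB, htf, hcov⟩ := hB.finite_cover_balls hδ
  have hex : ∀ y ∈ B, ∃ i : htf.toFinset, dist y i < δ := by
    intro y hy
    obtain ⟨c, hc, hyc⟩ := Set.mem_iUnion₂.1 (hcov hy)
    exact ⟨⟨c, htf.mem_toFinset.2 hc⟩, hyc⟩
  let e := htf.toFinset.equivFin
  let near (y : F) (i : htf.toFinset) : Prop :=
    ∃ hy : ∃ i : htf.toFinset, dist y i < δ, i = hy.choose
  refine ⟨htf.toFinset.card,
    fun x y => ∑ j, f x (e.symm j) * (if near y (e.symm j) then 1 else 0),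
    ⟨fun j x => f x (e.symm j), fun j y => if near y (e.symm j) then 1 else 0,
      fun x y => rfl⟩, fun x hx y hy => ?_⟩
  have hi := hex y hy
  have hsum : ∑ j, f x (e.symm j) * (if near y (e.symm j) then 1 else 0) = f x hi.choose := by
    rw [e.symm.sum_comp fun i : htf.toFinset => f x i * (if near y i then 1 else 0),
      Finset.sum_eq_single hi.choose]
    · rw [if_pos ⟨hi, rfl⟩, mul_one]
    · rintro i - hne
      rw [if_neg fun ⟨_, hi'⟩ => hne hi', mul_zero]
    · simp
  simp only [hsum, ← dist_eq_norm]
  refine (h (x, y) ⟨hx, hy⟩ (x, hi.choose) ⟨hx, htB (htf.mem_toFinset.1 hi.choose.2)⟩ ?_).le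
  simpa [Prod.dist_eq, hδ] using hi.choose_spec

end Separated

/-! ### The Hankel function in scaled coordinates -/

/-- The distance `|x - y| / (d λ)` in terms of the scaled coordinates
`ξ = (x₁ / (d λ), x₂ / (√d λ))` and `η = (y₁ / (d λ), y₂ / (√d λ))`, where `κ = 1 / d`. -/
noncomputable def scaledDist (κ : ℝ) (ξ η : ℝ × ℝ) : ℝ :=
  √((ξ.1 - η.1) ^ 2 + κ * (ξ.2 - η.2) ^ 2)

/-- A rectangle containing the image of `R₁` in scaled coordinates, whatever `d`, `h₁`, `h₂`. -/
def rightBox : Set (ℝ × ℝ) := Set.Icc (1 / 2) (3 / 2) ×ˢ Set.Icc (-(1 / 2)) (1 / 2)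

/-- A rectangle containing the image of `R₂` in scaled coordinates, whatever `d`, `h₁`, `h₂`. -/
def leftBox : Set (ℝ × ℝ) := Set.Icc (-(3 / 2)) (-(1 / 2)) ×ˢ Set.Icc (-(1 / 2)) (1 / 2)

lemma isCompact_rightBox : IsCompact rightBox := isCompact_Icc.prod isCompact_Icc

lemma isCompact_leftBox : IsCompact leftBox := isCompact_Icc.prod isCompact_Icc

lemma one_le_sub_of_mem_box {ξ η : ℝ × ℝ} (hξ : ξ ∈ rightBox) (hη : η ∈ leftBox) :
    1 ≤ ξ.1 - η.1 := by
  linarith [hξ.1.1, hη.1.2]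

lemma one_le_scaledDist {κ : ℝ} (hκ : 0 ≤ κ) {ξ η : ℝ × ℝ} (hξ : ξ ∈ rightBox)
    (hη : η ∈ leftBox) : 1 ≤ scaledDist κ ξ η := by
  have h := one_le_sub_of_mem_box hξ hη
  refine Real.one_le_sqrt.2 ?_
  nlinarith [mul_nonneg hκ (sq_nonneg (ξ.2 - η.2))]

lemma scaledDist_le_four {κ : ℝ} (hκ : κ ≤ 1) {ξ η : ℝ × ℝ} (hξ : ξ ∈ rightBox)
    (hη : η ∈ leftBox) : scaledDist κ ξ η ≤ 4 := by
  refine Real.sqrt_le_iff.2 ⟨by norm_num, ?_⟩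
  have h := one_le_sub_of_mem_box hξ hη
  have h3 : ξ.1 - η.1 ≤ 3 := by linarith [hξ.1.2, hη.1.1]
  have h4 : (ξ.2 - η.2) ^ 2 ≤ 1 := by
    refine (sq_le_one_iff_abs_le_one _).2 (abs_le.2 ⟨?_, ?_⟩) <;>
      linarith [hξ.2.1, hξ.2.2, hη.2.1, hη.2.2]
  nlinarith [mul_le_mul_of_nonneg_right hκ (sq_nonneg (ξ.2 - η.2))]

lemma continuous_scaledDist {X : Type*} [TopologicalSpace X] {k : X → ℝ} {a b : X → ℝ × ℝ}
    (hk : Continuous k) (ha : Continuous a) (hb : Continuous b) :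
    Continuous fun x => scaledDist (k x) (a x) (b x) := by
  unfold scaledDist; fun_prop

/-- The phase `d ρ` of the Hankel function is the separated phase `d (ξ₁ - η₁)` up to a correction
which stays bounded, and continuous in `κ = 1 / d`, down to `κ = 0`. -/
lemma mul_scaledDist {d : ℝ} (hd : 1 ≤ d) {ξ η : ℝ × ℝ} (hξ : ξ ∈ rightBox) (hη : η ∈ leftBox) :
    d * scaledDist (1 / d) ξ η =
      d * ξ.1 - d * η.1 + (ξ.2 - η.2) ^ 2 / (scaledDist (1 / d) ξ η + (ξ.1 - η.1)) := by
  have hd0 : 0 < d := by linarith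
  have h1 := one_le_sub_of_mem_box hξ hη
  have h2 := one_le_scaledDist (by positivity : 0 ≤ 1 / d) hξ hη
  have hsq : scaledDist (1 / d) ξ η ^ 2 = (ξ.1 - η.1) ^ 2 + 1 / d * (ξ.2 - η.2) ^ 2 :=
    Real.sq_sqrt (by positivity)
  have hne : scaledDist (1 / d) ξ η + (ξ.1 - η.1) ≠ 0 := by linarith
  rw [← sub_eq_iff_eq_add', eq_div_iff hne]
  have hdd : d * (1 / d) = 1 := by field_simp
  linear_combination d * hsq + (ξ.2 - η.2) ^ 2 * hdd

/-- The plane-wave factors are split off exactly, and what remains is continuous on a compact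
set that includes the limit `κ = 0`; this makes the number of terms independent of `d`. -/
lemma exists_isSeparatedSum_exp (s : ℝ) {ε : ℝ} (hε : 0 < ε) :
    ∃ n, ∀ d : ℝ, 1 ≤ d → ∃ g, IsSeparatedSum n g ∧ ∀ ξ ∈ rightBox, ∀ η ∈ leftBox,
      ‖Complex.exp ((s * (d * scaledDist (1 / d) ξ η) : ℝ) * Complex.I) /
        (√(scaledDist (1 / d) ξ η) : ℂ) - g ξ η‖ ≤ ε := by
  let f : ℝ × (ℝ × ℝ) → ℝ × ℝ → ℂ := fun p η =>
    Complex.exp ((s * ((p.2.2 - η.2) ^ 2 / (scaledDist p.1 p.2 η + (p.2.1 - η.1))) : ℝ) *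
      Complex.I) / (√(scaledDist p.1 p.2 η) : ℂ)
  have hρ : Continuous fun q : (ℝ × (ℝ × ℝ)) × (ℝ × ℝ) => scaledDist q.1.1 q.1.2 q.2 :=
    continuous_scaledDist (by fun_prop) (by fun_prop) (by fun_prop)
  have hf : ContinuousOn (fun q : (ℝ × (ℝ × ℝ)) × (ℝ × ℝ) => f q.1 q.2)
      ((Set.Icc 0 1 ×ˢ rightBox) ×ˢ leftBox) := by
    refine ContinuousOn.div ?_
      (Complex.continuous_ofReal.comp hρ.sqrt).continuousOn ?_
    · refine Complex.continuous_exp.comp_continuousOn ?_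
      refine (Complex.continuous_ofReal.comp_continuousOn ?_).mul continuousOn_const
      refine continuousOn_const.mul (ContinuousOn.div (by fun_prop) (by fun_prop) ?_)
      rintro q ⟨⟨hκ, hξ⟩, hη⟩
      linarith [one_le_sub_of_mem_box hξ hη, one_le_scaledDist hκ.1 hξ hη]
    · rintro q ⟨⟨hκ, hξ⟩, hη⟩
      have := one_le_scaledDist hκ.1 hξ hη
      rw [Ne, Complex.ofReal_eq_zero, Real.sqrt_eq_zero']
      linarith
  obtain ⟨n, g, hg, hfg⟩ := exists_isSeparatedSum_near
    (isCompact_Icc.prod isCompact_rightBox) isCompact_leftBox hf hε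
  refine ⟨n, fun d hd => ?_⟩
  have hd0 : 0 < d := by linarith
  have hκ : 1 / d ∈ Set.Icc (0 : ℝ) 1 := ⟨by positivity, (div_le_one hd0).2 hd⟩
  refine ⟨_, (hg.comp (fun ξ : ℝ × ℝ => ((1 / d, ξ) : ℝ × (ℝ × ℝ))) id).mul
    (fun ξ => Complex.exp ((s * (d * ξ.1) : ℝ) * Complex.I))
    (fun η => Complex.exp ((-(s * (d * η.1)) : ℝ) * Complex.I)), fun ξ hξ η hη => ?_⟩
  have heq : Complex.exp ((s * (d * scaledDist (1 / d) ξ η) : ℝ) * Complex.I) /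
      (√(scaledDist (1 / d) ξ η) : ℂ) = Complex.exp ((s * (d * ξ.1) : ℝ) * Complex.I) *
        Complex.exp ((-(s * (d * η.1)) : ℝ) * Complex.I) * f (1 / d, ξ) η := by
    rw [mul_scaledDist hd hξ hη, ← mul_div_assoc, ← Complex.exp_add, ← Complex.exp_add]
    congr 2
    push_cast
    ring
  rw [heq, ← mul_sub, norm_mul, norm_mul, Complex.norm_exp_ofReal_mul_I,
    Complex.norm_exp_ofReal_mul_I, one_mul, one_mul]
  exact hfg (1 / d, ξ) ⟨hκ, hξ⟩ η hη

/-- The Green's function in scaled coordinates, up to a constant factor. -/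
noncomputable def scaledHankel (d : ℝ) (ξ η : ℝ × ℝ) : ℂ :=
  √(2 * Real.pi * d) * hankelH10 (2 * Real.pi * (d * scaledDist (1 / d) ξ η))

lemma scaledHankel_eq {d : ℝ} (hd : 1 ≤ d) {ξ η : ℝ × ℝ} (hξ : ξ ∈ rightBox)
    (hη : η ∈ leftBox) :
    scaledHankel d ξ η = √(2 * Real.pi * (d * scaledDist (1 / d) ξ η)) *
      hankelH10 (2 * Real.pi * (d * scaledDist (1 / d) ξ η)) / √(scaledDist (1 / d) ξ η) := by
  have hd0 : 0 < d := by linarith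
  have h := one_le_scaledDist (by positivity : 0 ≤ 1 / d) hξ hη
  have hs : (√(scaledDist (1 / d) ξ η) : ℂ) ≠ 0 := by
    rw [Ne, Complex.ofReal_eq_zero, Real.sqrt_eq_zero']
    linarith
  rw [scaledHankel, eq_div_iff hs, ← mul_assoc (2 * Real.pi),
    Real.sqrt_mul (by positivity : 0 ≤ 2 * Real.pi * d)]
  push_cast
  ring

lemma le_two_pi_mul_scaledDist {d : ℝ} (hd : 1 ≤ d) {ξ η : ℝ × ℝ} (hξ : ξ ∈ rightBox)
    (hη : η ∈ leftBox) : d ≤ 2 * Real.pi * (d * scaledDist (1 / d) ξ η) := by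
  have hd0 : 0 < d := by linarith
  have h := one_le_scaledDist (by positivity : 0 ≤ 1 / d) hξ hη
  have hpi := Real.pi_gt_three
  have h1 : d ≤ d * scaledDist (1 / d) ξ η := le_mul_of_one_le_right hd0.le h
  nlinarith

lemma exists_le_norm_scaledHankel :
    ∃ c, 0 < c ∧ ∀ d, 1 ≤ d → ∀ ξ ∈ rightBox, ∀ η ∈ leftBox, c ≤ ‖scaledHankel d ξ η‖ := by
  obtain ⟨c, hc, h⟩ := exists_le_sqrt_mul_norm_hankelH10
  refine ⟨c / 2, by positivity, fun d hd ξ hξ η hη => ?_⟩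
  have hd0 : 0 < d := by linarith
  have hρ := one_le_scaledDist (by positivity : 0 ≤ 1 / d) hξ hη
  have hρ4 := scaledDist_le_four ((div_le_one hd0).2 hd) hξ hη
  have hs : √(scaledDist (1 / d) ξ η) ≤ 2 := Real.sqrt_le_iff.2 ⟨by norm_num, by linarith⟩
  have hs0 : 0 < √(scaledDist (1 / d) ξ η) := Real.sqrt_pos.2 (by linarith)
  rw [scaledHankel_eq hd hξ hη, norm_div, norm_mul, Complex.norm_real, Complex.norm_real,
    Real.norm_of_nonneg (Real.sqrt_nonneg _), Real.norm_of_nonneg (Real.sqrt_nonneg _)]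
  exact div_le_div₀ (by positivity) (h _ (hd.trans (le_two_pi_mul_scaledDist hd hξ hη))) hs0 hs

lemma exists_isSeparatedSum_scaledHankel_of_le (D : ℝ) {ε : ℝ} (hε : 0 < ε) :
    ∃ n, ∀ d : ℝ, 1 ≤ d → d ≤ D → ∃ g, IsSeparatedSum n g ∧ ∀ ξ ∈ rightBox, ∀ η ∈ leftBox,
      ‖scaledHankel d ξ η - g ξ η‖ ≤ ε := by
  have hf : ContinuousOn (fun q : (ℝ × (ℝ × ℝ)) × (ℝ × ℝ) => scaledHankel q.1.1 q.1.2 q.2)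
      ((Set.Icc 1 D ×ˢ rightBox) ×ˢ leftBox) := by
    rintro q ⟨⟨hd, hξ⟩, hη⟩
    have hd0 : 0 < q.1.1 := by linarith [hd.1]
    refine ContinuousAt.continuousWithinAt (ContinuousAt.mul (by fun_prop) ?_)
    refine ContinuousAt.comp (g := hankelH10) (continuousAt_hankelH10
      (hd0.trans_le (le_two_pi_mul_scaledDist hd.1 hξ hη))) ?_
    have hκ : ContinuousAt (fun q : (ℝ × (ℝ × ℝ)) × (ℝ × ℝ) => 1 / q.1.1) q :=
      continuousAt_const.div (by fun_prop) hd0.ne'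
    unfold scaledDist
    fun_prop
  obtain ⟨n, g, hg, hfg⟩ := exists_isSeparatedSum_near
    (f := fun (p : ℝ × (ℝ × ℝ)) η => scaledHankel p.1 p.2 η)
    (isCompact_Icc.prod isCompact_rightBox) isCompact_leftBox hf hε
  exact ⟨n, fun d h1 hD => ⟨_, hg.comp (fun ξ : ℝ × ℝ => ((d, ξ) : ℝ × (ℝ × ℝ))) id,
    fun ξ hξ η hη => hfg (d, ξ) ⟨⟨h1, hD⟩, hξ⟩ η hη⟩⟩

lemma exists_isSeparatedSum_scaledHankel_of_ge {ε : ℝ} (hε : 0 < ε) :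
    ∃ D n, ∀ d : ℝ, 1 ≤ d → D ≤ d → ∃ g, IsSeparatedSum n g ∧ ∀ ξ ∈ rightBox, ∀ η ∈ leftBox,
      ‖scaledHankel d ξ η - g ξ η‖ ≤ ε := by
  obtain ⟨A, B, hAB⟩ := exists_tendsto_hankelH10
  obtain ⟨D, hD⟩ := eventually_atTop.1 (Metric.tendsto_nhds.1 hAB (ε / 3) (by positivity))
  have hδ : ∀ C : ℂ, 0 < ε / (3 * (‖C‖ + 1)) := fun C => by positivity
  obtain ⟨m, hm⟩ := exists_isSeparatedSum_exp (2 * Real.pi) (hδ A)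
  obtain ⟨n, hn⟩ := exists_isSeparatedSum_exp (-(2 * Real.pi)) (hδ B)
  refine ⟨D, m + n, fun d hd hDd => ?_⟩
  obtain ⟨g, hg, hg'⟩ := hm d hd
  obtain ⟨k, hk, hk'⟩ := hn d hd
  refine ⟨_, (hg.mul (fun _ => A) (fun _ => 1)).add (hk.mul (fun _ => B) (fun _ => 1)),
    fun ξ hξ η hη => ?_⟩
  have hz := hD _ (hDd.trans (le_two_pi_mul_scaledDist hd hξ hη))
  have h1 := hg' ξ hξ η hη
  have h2 := hk' ξ hξ η hη
  have hd0 : 0 < d := by linarith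
  have hs : 1 ≤ √(scaledDist (1 / d) ξ η) :=
    Real.one_le_sqrt.2 (one_le_scaledDist (by positivity) hξ hη)
  have hb : ∀ (C v : ℂ), ‖v‖ ≤ ε / (3 * (‖C‖ + 1)) → ‖C * v‖ ≤ ε / 3 := by
    intro C v hv
    rw [norm_mul]
    calc ‖C‖ * ‖v‖ ≤ (‖C‖ + 1) * (ε / (3 * (‖C‖ + 1))) := by
          gcongr; linarith
      _ = ε / 3 := by field_simp
  rw [scaledHankel_eq hd hξ hη]
  rw [dist_zero_right] at hz
  set z := 2 * Real.pi * (d * scaledDist (1 / d) ξ η)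
  set s := √(scaledDist (1 / d) ξ η)
  have e2 : ((-(2 * Real.pi) * (d * scaledDist (1 / d) ξ η) : ℝ) : ℂ) * Complex.I =
      -(Complex.I * z) := by simp only [z]; push_cast; ring
  rw [e2] at h2
  rw [mul_comm _ Complex.I] at h1
  have h3 : ‖(√z * hankelH10 z -
      (A * Complex.exp (Complex.I * z) + B * Complex.exp (-(Complex.I * z)))) / (s : ℂ)‖ ≤
        ε / 3 := by
    rw [norm_div, Complex.norm_real, Real.norm_of_nonneg (by linarith)]
    exact (div_le_self (norm_nonneg _) hs).trans hz.le
  calc _ = ‖(√z * hankelH10 z -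
      (A * Complex.exp (Complex.I * z) + B * Complex.exp (-(Complex.I * z)))) / (s : ℂ) +
        A * (Complex.exp (Complex.I * z) / s - g ξ η) +
        B * (Complex.exp (-(Complex.I * z)) / s - k ξ η)‖ := by congr 1; ring
    _ ≤ ε / 3 + ε / 3 + ε / 3 := norm_add₃_le.trans (by gcongr; exacts [hb _ _ h1, hb _ _ h2])
    _ = ε := by ring

lemma exists_isSeparatedSum_scaledHankel {ε : ℝ} (hε : 0 < ε) :
    ∃ n, ∀ d : ℝ, 1 ≤ d → ∃ g, IsSeparatedSum n g ∧ ∀ ξ ∈ rightBox, ∀ η ∈ leftBox,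
      ‖scaledHankel d ξ η - g ξ η‖ ≤ ε := by
  obtain ⟨D, m, hm⟩ := exists_isSeparatedSum_scaledHankel_of_ge hε
  obtain ⟨n, hn⟩ := exists_isSeparatedSum_scaledHankel_of_le D hε
  refine ⟨m + n, fun d hd => ?_⟩
  rcases le_total D d with h | h
  · obtain ⟨g, hg, hg'⟩ := hm d hd h
    exact ⟨_, hg.add (isSeparatedSum_zero n), by simpa using hg'⟩
  · obtain ⟨g, hg, hg'⟩ := hn d hd h
    exact ⟨_, (isSeparatedSum_zero m).add hg, by simpa using hg'⟩

/-! ### Back to the rectangles -/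

/-- Scaled coordinates: the horizontal unit is `d` wavelengths, the vertical unit `√d`. -/
noncomputable def scaledCoord (ω d : ℝ) (x : EuclideanSpace ℝ (Fin 2)) : ℝ × ℝ :=
  (x 0 / (d * wavelength ω), x 1 / (√d * wavelength ω))

lemma wavelength_pos {ω : ℝ} (hω : 0 < ω) : 0 < wavelength ω := by
  unfold wavelength; positivity

lemma helmholtzGreen_eq {ω d : ℝ} (hω : 0 < ω) (hd : 0 < d) (x y : EuclideanSpace ℝ (Fin 2)) :
    helmholtzGreen ω x y = Complex.I / 4 / √(2 * Real.pi * d) *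
      scaledHankel d (scaledCoord ω d x) (scaledCoord ω d y) := by
  have hs : (√(2 * Real.pi * d) : ℂ) ≠ 0 := by
    rw [Ne, Complex.ofReal_eq_zero, Real.sqrt_eq_zero', not_le]; positivity
  have hl := wavelength_pos hω
  have hdist : ‖x - y‖ = d * wavelength ω *
      scaledDist (1 / d) (scaledCoord ω d x) (scaledCoord ω d y) := by
    rw [EuclideanSpace.norm_eq, scaledDist, ← Real.sqrt_sq (by positivity : 0 ≤ d * wavelength ω),
      ← Real.sqrt_mul (by positivity)]
    congr 1
    simp only [Fin.sum_univ_two, PiLp.sub_apply, Real.norm_eq_abs, sq_abs, scaledCoord]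
    obtain ⟨r, hr, rfl⟩ : ∃ r, 0 < r ∧ d = r ^ 2 :=
      ⟨√d, Real.sqrt_pos.2 hd, (Real.sq_sqrt hd.le).symm⟩
    rw [Real.sqrt_sq hr.le]
    field_simp
  have harg : ω * ‖x - y‖ =
      2 * Real.pi * (d * scaledDist (1 / d) (scaledCoord ω d x) (scaledCoord ω d y)) := by
    rw [hdist, wavelength]; field_simp
  rw [helmholtzGreen, harg, scaledHankel]
  field_simp

/-- The height condition is what keeps the scaled vertical coordinate bounded. -/
lemma scaled_height_mem {l d h t : ℝ} (hl : 0 < l) (hd : 0 < d) (hh : 0 ≤ h → h ^ 2 ≤ d)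
    (ht : t ∈ Set.Icc (-(h / 2) * l) (h / 2 * l)) :
    t / (√d * l) ∈ Set.Icc (-(1 / 2) : ℝ) (1 / 2) := by
  have hs := Real.sqrt_pos.2 hd
  have h0 : 0 ≤ h := by
    have := ht.1.trans ht.2
    by_contra hneg
    nlinarith
  have hle : h ≤ √d := Real.le_sqrt_of_sq_le (hh h0)
  have hmul := mul_le_mul_of_nonneg_right hle hl.le
  constructor
  · rw [le_div_iff₀ (by positivity)]; nlinarith [ht.1]
  · rw [div_le_iff₀ (by positivity)]; nlinarith [ht.2]

lemma sq_le_of_two_mul_max_sq_le {a b d : ℝ} (h : 2 * max a b ^ 2 ≤ d) (ha : 0 ≤ a) :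
    a ^ 2 ≤ d := by
  have := pow_le_pow_left₀ ha (le_max_left a b) 2
  nlinarith [sq_nonneg a]

theorem theorem1 :
    ∃ ε₀ : ℝ, 0 < ε₀ ∧ ∀ ε : ℝ, 0 < ε → ε < ε₀ →
      ∃ C : ℕ, ∀ ω d h₁ h₂ : ℝ, 0 < ω → 1 < d → 2 * max h₁ h₂ ^ 2 ≤ d →
        HasSeparatedApprox (helmholtzGreen ω)
          (planeRect (d / 2 * wavelength ω) (3 * d / 2 * wavelength ω)
            (-(h₁ / 2) * wavelength ω) (h₁ / 2 * wavelength ω))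
          (planeRect (-(3 * d / 2) * wavelength ω) (-(d / 2) * wavelength ω)
            (-(h₂ / 2) * wavelength ω) (h₂ / 2 * wavelength ω))
          C ε := by
  -- No smallness of `ε` is needed, so any `ε₀` serves.
  refine ⟨1, one_pos, fun ε hε _ => ?_⟩
  obtain ⟨c, hc, hlow⟩ := exists_le_norm_scaledHankel
  obtain ⟨n, hn⟩ := exists_isSeparatedSum_scaledHankel (mul_pos hε hc)
  refine ⟨n, fun ω d h₁ h₂ hω hd hh => ?_⟩
  have hd0 : 0 < d := by linarith
  have hl := wavelength_pos hω
  obtain ⟨g, hg, hg'⟩ := hn d hd.le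
  obtain ⟨α, β, hαβ⟩ := (hg.comp (scaledCoord ω d) (scaledCoord ω d)).mul
    (fun _ => Complex.I / 4 / √(2 * Real.pi * d)) (fun _ => 1)
  refine ⟨α, β, fun x hx y hy => ?_⟩
  have hξ : scaledCoord ω d x ∈ rightBox := by
    refine ⟨⟨?_, ?_⟩, scaled_height_mem hl hd0 (sq_le_of_two_mul_max_sq_le hh) hx.2⟩
    · rw [scaledCoord, le_div_iff₀ (by positivity)]; linarith [hx.1.1]
    · rw [scaledCoord, div_le_iff₀ (by positivity)]; linarith [hx.1.2]
  have hη : scaledCoord ω d y ∈ leftBox := by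
    refine ⟨⟨?_, ?_⟩, scaled_height_mem hl hd0
      (sq_le_of_two_mul_max_sq_le (max_comm h₁ h₂ ▸ hh)) hy.2⟩
    · rw [scaledCoord, le_div_iff₀ (by positivity)]; linarith [hy.1.1]
    · rw [scaledCoord, div_le_iff₀ (by positivity)]; linarith [hy.1.2]
  rw [← hαβ, helmholtzGreen_eq hω hd0, mul_one, ← mul_sub, norm_mul, norm_mul, mul_left_comm]
  refine mul_le_mul_of_nonneg_left ((hg' _ hξ _ hη).trans ?_) (norm_nonneg _)
  exact mul_le_mul_of_nonneg_left (hlow d hd.le _ hξ _ hη) hε.le
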